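/- Let $X_1,X_2,\dots$ be independent, identically distributed real random variables on a probability space, having the law of a random variable $X$ with a bounded probability density function $f$ on $\mathbb R$. For $1\le m<n$ let $X_{(1)}\le\dots\le X_{(n)}$ be the order statistics of $X_1,\dots,X_n$ and put $$T'_{m,n}=\frac1{n-m}\sum_{j=1}^{n-m}\Big(\frac{m}{n+1}\,\frac1{X_{(j+m)}-X_{(j)}}\Big)^2,\qquad T''_{m,n}=\frac1{n-m}\sum_{j=1}^{n-m}\frac{m}{n+1}\,\frac1{X_{(j+m)}-X_{(j)}},$$ $$VJV_{m,n}=\tfrac14\big\{T'_{m,n}-(T''_{m,n})^2\big\}.$$ Let $VJ(X)=\operatorname{Var}\big[-\tfrac12 f(X)\big]$ be the varextropy of $X$. Let $m=m_n$ be a (deterministic) sequence of positive integers with $m_n\to\infty$, $m_n/\log n\to\infty$ and $m_n/n\to0$ as $n\to\infty$. Then $$VJ(X)=\tfrac14\int_{\mathbb R} f(x)^3\,dx-\tfrac14\Big(\int_{\mathbb R} f(x)^2\,dx\Big)^2,$$ and $VJV_{m_n,n}\to VJ(X)$ almost surely as $n\to\infty$. -/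

import Mathlib

open MeasureTheory ProbabilityTheory Filter Topology

noncomputable section

/-- The order statistics of a sample of size `n`: the entry with (zero-based) index `j` is the
`(j + 1)`-st smallest value, usually written `X_(j+1)`, with repetitions. -/
def orderStat {n : ℕ} (x : Fin n → ℝ) : Fin n → ℝ :=
  x ∘ Tuple.sort x

/-- The local histogram estimate `m / (n + 1) * (X_(j+m) - X_(j))⁻¹` of the density at `X_(j)`;
the zero-based `j : Fin (n - m)` corresponds to `j = 1, …, n - m`. -/
def spacingDensity {n : ℕ} (m : ℕ) (x : Fin n → ℝ) (j : Fin (n - m)) : ℝ :=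
  (m : ℝ) / ((n : ℝ) + 1) *
    (orderStat x ⟨(j : ℕ) + m, by omega⟩ - orderStat x ⟨(j : ℕ), by omega⟩)⁻¹

/-- The estimator `T'_{m,n}` of `∫ f ^ 3`. -/
def spacingT' {n : ℕ} (m : ℕ) (x : Fin n → ℝ) : ℝ :=
  1 / ((n : ℝ) - (m : ℝ)) * ∑ j : Fin (n - m), spacingDensity m x j ^ 2

/-- The estimator `T''_{m,n}` of `∫ f ^ 2`. -/
def spacingT'' {n : ℕ} (m : ℕ) (x : Fin n → ℝ) : ℝ :=
  1 / ((n : ℝ) - (m : ℝ)) * ∑ j : Fin (n - m), spacingDensity m x j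

/-- The spacing-based varextropy estimator `VJV_{m,n}`. -/
def VJV {n : ℕ} (m : ℕ) (x : Fin n → ℝ) : ℝ :=
  1 / 4 * (spacingT' m x - spacingT'' m x ^ 2)

/-- The varextropy `Var[-f(X)/2]` of a random variable `X` with density `f`. -/
def varextropy {Ω : Type*} [MeasurableSpace Ω] (P : Measure Ω) (X : Ω → ℝ) (f : ℝ → ℝ) : ℝ :=
  variance (fun ω => -(1 / 2) * f (X ω)) P

end

/-! Let `F` be the cdf and `μ` the law of `X`. Along a spacing `(X_(j), X_(j+m)]` of `μ`-mass close
to `m/n`, the histogram estimate is nearly the difference quotient of `F` across it. Since `m/n →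
0`, at `μ`-almost every point `t` (where `F' = f > 0`) the spacings containing `t` shrink to `t`, so
their estimates tend to `f t`. The spacings cover each point at most `m` times, so an average over
them behaves like an integral against `μ`. Boundedness of `f` supplies domination, and averages of
`p`-th powers tend to `∫ f^p dμ = ∫ f^(p+1) dx`; the cases `p = 1, 2` give the theorem
(`tendsto_average_of_local_tendsto`, `tendsto_average_spacingDensity_pow`).

Randomness enters only in showing that, almost surely, all spacings have mass `(m/n)(1 + o(1))`
uniformly in `j`. The values `F(X_i)` are uniform on `[0,1)`. Cut this interval into about `L n / m`
cells: a Chernoff bound, a union bound and Borel–Cantelli, which need `m / log n → ∞`, show that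
every cell count is eventually within a factor `1 ± 1/L` of its mean
(`ae_eventually_abs_cellCount_sub_le`). Counting the cells met by a spacing then gives its mass up
to a relative error `6/L` (`abs_spacing_sub_one_le_of_cellCount`). -/

/-! ### Averages of locally convergent weights -/

open Classical in
/-- If weights `s n j` attached to sets `I n j`, which cover each point at most `k n` times and have
average mass close to `k n / N n`, converge to `φ x` along the sets containing `x`, then their
averages converge to the integral of `φ`. -/
theorem tendsto_average_of_local_tendsto {α : Type*} [MeasurableSpace α] (μ : Measure α)
    [IsProbabilityMeasure μ] (N k : ℕ → ℕ) (I : ∀ n, Fin (N n) → Set α)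
    (hI : ∀ n j, MeasurableSet (I n j))
    (s : ∀ n, Fin (N n) → ℝ) (φ : α → ℝ) (hφ : Measurable φ) (C : ℝ) (hφC : ∀ x, |φ x| ≤ C)
    (hN : ∀ᶠ n in atTop, 0 < N n)
    (hoverlap : ∀ n x, (Finset.univ.filter (fun j => x ∈ I n j)).card ≤ k n)
    (hsC : ∀ᶠ n in atTop, ∀ j, |s n j| ≤ C)
    (hlocal : ∀ᵐ x ∂μ, ∀ ε > 0, ∀ᶠ n in atTop, ∀ j, x ∈ I n j → |s n j - φ x| ≤ ε)
    (hmass : Tendsto (fun n => ∑ j, |1 / (N n : ℝ) - μ.real (I n j) / k n|) atTop (𝓝 0)) :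
    Tendsto (fun n => 1 / (N n : ℝ) * ∑ j, s n j) atTop (𝓝 (∫ x, φ x ∂μ)) := by
  have hφi : Integrable φ μ :=
    Integrable.of_bound hφ.aestronglyMeasurable C (ae_of_all _ hφC)
  -- `H` averages the local errors and `G` is the normalised covering multiplicity. `∫ H → 0` by
  -- dominated convergence; `∫ G → 1` with `G ≤ 1` lets `∫ G φ` be replaced by `∫ φ`.
  set H : ℕ → α → ℝ := fun n x =>
    1 / (k n : ℝ) * ∑ j, (I n j).indicator (fun x => s n j - φ x) x with hH
  set G : ℕ → α → ℝ := fun n x =>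
    1 / (k n : ℝ) * ∑ j, (I n j).indicator (fun _ => (1 : ℝ)) x with hG
  have hcount : ∀ n x, ∑ j, (I n j).indicator (fun _ => (1 : ℝ)) x ≤ k n := by
    intro n x
    classical
    simp only [Set.indicator_apply, Finset.sum_boole]
    exact_mod_cast hoverlap n x
  have hHbound : ∀ n x c, 0 ≤ c → (∀ j, x ∈ I n j → |s n j - φ x| ≤ c) → |H n x| ≤ c := by
    intro n x c hc h
    simp only [hH, abs_mul]
    have h1 : |∑ j, (I n j).indicator (fun x => s n j - φ x) x| ≤ c * k n := by
      calc _ ≤ ∑ j, |(I n j).indicator (fun x => s n j - φ x) x| := Finset.abs_sum_le_sum_abs _ _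
        _ ≤ ∑ j, c * (I n j).indicator (fun _ => (1 : ℝ)) x := by
          refine Finset.sum_le_sum fun j _ => ?_
          by_cases hx : x ∈ I n j
          · simpa [hx] using h j hx
          · simp [hx]
        _ = c * ∑ j, (I n j).indicator (fun _ => (1 : ℝ)) x := by rw [Finset.mul_sum]
        _ ≤ c * k n := mul_le_mul_of_nonneg_left (hcount n x) hc
    rw [abs_of_nonneg (by positivity : (0 : ℝ) ≤ 1 / k n)]
    calc 1 / (k n : ℝ) * _ ≤ 1 / (k n : ℝ) * (c * k n) := by gcongr
      _ = c * ((k n : ℝ) / k n) := by ring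
      -- Only an inequality, because `k n = 0` is allowed and the quotient is then `0`.
      _ ≤ c * 1 := by gcongr; exact div_self_le_one _
      _ = c := mul_one c
  have hHlim : Tendsto (fun n => ∫ x, H n x ∂μ) atTop (𝓝 0) := by
    have : (0 : ℝ) = ∫ _, (0 : ℝ) ∂μ := by simp
    rw [this]
    refine tendsto_integral_filter_of_dominated_convergence (fun _ => C + C) ?_ ?_
      (integrable_const _) ?_
    · refine Eventually.of_forall fun n => Measurable.aestronglyMeasurable ?_
      refine measurable_const.mul (Finset.measurable_fun_sum _ fun j _ => ?_)
      exact (measurable_const.sub hφ).indicator (hI n j)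
    · filter_upwards [hsC] with n hn
      refine ae_of_all _ fun x => ?_
      have hC : 0 ≤ C := (abs_nonneg _).trans (hφC x)
      exact hHbound n x _ (by linarith) fun j _ =>
        (abs_sub _ _).trans (add_le_add (hn j) (hφC x))
    · filter_upwards [hlocal] with x hx
      rw [Metric.tendsto_nhds]
      intro ε hε
      filter_upwards [hx (ε / 2) (by positivity)] with n hn
      rw [dist_zero_right, Real.norm_eq_abs]
      exact (hHbound n x _ (by positivity) hn).trans_lt (by linarith)
  have hind : ∀ n j, Integrable ((I n j).indicator fun _ => (1 : ℝ)) μ := fun n j =>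
    (integrable_const _).indicator (hI n j)
  have hGi : ∀ n, Integrable (G n) μ := fun n =>
    (integrable_finsetSum _ fun j _ => hind n j).const_mul _
  have hGint : ∀ n, ∫ x, G n x ∂μ = ∑ j, μ.real (I n j) / k n := by
    intro n
    simp only [hG]
    rw [integral_const_mul, integral_finsetSum _ fun j _ => hind n j, Finset.mul_sum]
    refine Finset.sum_congr rfl fun j _ => ?_
    rw [integral_indicator (hI n j)]
    simp [div_eq_inv_mul]
  have hG1 : ∀ n x, G n x ≤ 1 := by
    intro n x
    calc G n x ≤ 1 / (k n : ℝ) * k n := by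
          simp only [hG]; gcongr; exact hcount n x
      _ ≤ 1 := by rw [one_div_mul_eq_div]; exact div_self_le_one _
  have hHint : ∀ n, ∫ x, H n x ∂μ =
      ∑ j, μ.real (I n j) / k n * s n j - ∫ x, G n x * φ x ∂μ := by
    intro n
    have e : ∀ x, H n x = 1 / (k n : ℝ) * ∑ j, (I n j).indicator (fun _ => (1 : ℝ)) x * s n j
        - G n x * φ x := by
      intro x
      simp only [hH, hG]
      rw [mul_assoc, ← mul_sub, Finset.sum_mul, ← Finset.sum_sub_distrib]
      congr 1
      refine Finset.sum_congr rfl fun j _ => ?_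
      by_cases hx : x ∈ I n j <;> simp [hx]
    have i1 : Integrable (fun x => 1 / (k n : ℝ) *
        ∑ j, (I n j).indicator (fun _ => (1 : ℝ)) x * s n j) μ :=
      (integrable_finsetSum _ fun j _ => (hind n j).mul_const _).const_mul _
    have i2 : Integrable (fun x => G n x * φ x) μ := by
      refine (hGi n).mul_bdd (c := C) hφ.aestronglyMeasurable (ae_of_all _ hφC)
    simp_rw [e]
    rw [integral_sub i1 i2, integral_const_mul,
      integral_finsetSum _ fun j _ => (hind n j).mul_const _, Finset.mul_sum]
    congr 1
    refine Finset.sum_congr rfl fun j _ => ?_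
    rw [integral_mul_const, integral_indicator (hI n j)]
    simp [div_eq_inv_mul, mul_assoc]
  have hC : 0 ≤ C := by
    obtain ⟨x⟩ : Nonempty α := μ.nonempty_of_neZero
    exact (abs_nonneg _).trans (hφC x)
  set e : ℕ → ℝ := fun n => ∑ j, |1 / (N n : ℝ) - μ.real (I n j) / k n| with he
  have key : ∀ᶠ n in atTop,
      dist (1 / (N n : ℝ) * ∑ j, s n j - ∫ x, H n x ∂μ) (∫ x, φ x ∂μ) ≤ 2 * C * e n := by
    filter_upwards [hN, hsC] with n hn hs
    have h1 : |1 / (N n : ℝ) * ∑ j, s n j - ∑ j, μ.real (I n j) / k n * s n j| ≤ C * e n := by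
      rw [Finset.mul_sum, ← Finset.sum_sub_distrib, he, Finset.mul_sum]
      refine (Finset.abs_sum_le_sum_abs _ _).trans (Finset.sum_le_sum fun j _ => ?_)
      rw [← sub_mul, abs_mul, mul_comm]
      exact mul_le_mul_of_nonneg_right (hs j) (abs_nonneg _)
    have h2 : |∫ x, G n x * φ x ∂μ - ∫ x, φ x ∂μ| ≤ C * e n := by
      have i2 : Integrable (fun x => G n x * φ x) μ :=
        (hGi n).mul_bdd (c := C) hφ.aestronglyMeasurable (ae_of_all _ hφC)
      rw [← integral_sub i2 hφi]
      -- `G ≤ 1` makes the defect `1 - G` nonnegative, so its integral needs no absolute value and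
      -- is a signed sum of the mass errors.
      calc |∫ x, (G n x * φ x - φ x) ∂μ| ≤ ∫ x, C * (1 - G n x) ∂μ := by
            have i3 : Integrable (fun x => C * (1 - G n x)) μ :=
              ((integrable_const 1).sub (hGi n)).const_mul C
            rw [← Real.norm_eq_abs]
            refine norm_integral_le_of_norm_le i3
              (ae_of_all _ fun x => ?_)
            rw [Real.norm_eq_abs, ← sub_one_mul, abs_mul, mul_comm, abs_sub_comm,
              abs_of_nonneg (sub_nonneg.2 (hG1 n x))]
            exact mul_le_mul_of_nonneg_right (hφC x) (sub_nonneg.2 (hG1 n x))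
        _ = C * (1 - ∑ j, μ.real (I n j) / k n) := by
            rw [integral_const_mul, integral_sub (integrable_const 1) (hGi n), hGint]; simp
        _ = C * ∑ j, (1 / (N n : ℝ) - μ.real (I n j) / k n) := by
            rw [Finset.sum_sub_distrib]
            have : (N n : ℝ) ≠ 0 := by positivity
            simp [this]
        _ ≤ C * e n := by
            gcongr
            exact Finset.sum_le_sum fun j _ => le_abs_self _
    rw [hHint, Real.dist_eq]
    rw [abs_le] at *
    constructor <;> linarith [h1.1, h1.2, h2.1, h2.2]
  have h3 : Tendsto (fun n => 1 / (N n : ℝ) * ∑ j, s n j - ∫ x, H n x ∂μ) atTop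
      (𝓝 (∫ x, φ x ∂μ)) := by
    rw [tendsto_iff_dist_tendsto_zero]
    refine squeeze_zero' (Eventually.of_forall fun n => dist_nonneg) key ?_
    simpa using hmass.const_mul (2 * C)
  simpa using h3.add hHlim

/-! ### Difference quotients at a point of differentiability -/

/-- Straddled difference quotients of `F` around a point of differentiability. -/
theorem HasDerivAt.exists_forall_abs_sub_le {F : ℝ → ℝ} {c x : ℝ} (h : HasDerivAt F c x) {ε : ℝ}
    (hε : 0 < ε) : ∃ δ > 0, ∀ a b, a ≤ x → x ≤ b → x - δ < a → b < x + δ →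
      |F b - F a - c * (b - a)| ≤ ε * (b - a) := by
  have h1 := (hasDerivAt_iff_isLittleO.1 h).def hε
  obtain ⟨δ, hδ, h2⟩ := Metric.eventually_nhds_iff.1 h1
  refine ⟨δ, hδ, fun a b ha hb ha' hb' => ?_⟩
  -- As `a ≤ x ≤ b`, the endpoint errors `ε (x - a)` and `ε (b - x)` add up to exactly `ε (b - a)`.
  have hA := @h2 a (by rw [Real.dist_eq, abs_lt]; constructor <;> linarith)
  have hB := @h2 b (by rw [Real.dist_eq, abs_lt]; constructor <;> linarith)
  simp only [Real.norm_eq_abs, smul_eq_mul] at hA hB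
  rw [abs_of_nonpos (by linarith : a - x ≤ 0)] at hA
  rw [abs_of_nonneg (by linarith : 0 ≤ b - x)] at hB
  rw [abs_le] at *
  constructor <;> linarith [hA.1, hA.2, hB.1, hB.2]

/-- Near a point of positive derivative of a monotone function `F`, intervals with small
`F`-increment are short. -/
theorem HasDerivAt.exists_forall_lt_of_sub_lt {F : ℝ → ℝ} (hF : Monotone F) {c x : ℝ}
    (h : HasDerivAt F c x) (hc : 0 < c) {δ : ℝ} (hδ : 0 < δ) :
    ∃ η > 0, ∀ a b, a ≤ x → x ≤ b → F b - F a < η → x - δ < a ∧ b < x + δ := by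
  obtain ⟨δ', hδ', h1⟩ := h.exists_forall_abs_sub_le (half_pos hc)
  set r := min δ (δ' / 2) with hr
  have hr0 : 0 < r := lt_min hδ (by linarith)
  have hrδ : r ≤ δ := min_le_left _ _
  have hrδ' : r ≤ δ' / 2 := min_le_right _ _
  -- By monotonicity, an interval reaching from `x` to `x ± r` has increment at least `(c/2) r`.
  refine ⟨c / 2 * r, by positivity, fun a b ha hb hab => ⟨?_, ?_⟩⟩
  · by_contra! hcon
    have h2 := (abs_le.1 (h1 (x - r) x (by linarith) le_rfl (by linarith) (by linarith))).1
    have h3 : F a ≤ F (x - r) := hF (by linarith)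
    have h4 := hF hb
    nlinarith
  · by_contra! hcon
    have h2 := (abs_le.1 (h1 x (x + r) le_rfl (by linarith) (by linarith) (by linarith))).1
    have h3 : F (x + r) ≤ F b := hF (by linarith)
    have h4 := hF ha
    nlinarith

/-! ### Spacings of a deterministic array -/

theorem monotone_orderStat {n : ℕ} (x : Fin n → ℝ) : Monotone (orderStat x) :=
  Tuple.monotone_sort x

/-- If `i` is the least index whose spacing contains `x`, an index `j ≥ i + m` would give `x ≤
y_(i+m) ≤ y_j < x`. The half-open form of the intervals supplies the strict inequality. -/
theorem card_filter_mem_Ioc_spacing_le {n m : ℕ} {y : Fin n → ℝ} (hy : Monotone y) (x : ℝ) :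
    (Finset.univ.filter fun j : Fin (n - m) =>
      x ∈ Set.Ioc (y ⟨(j : ℕ), by omega⟩) (y ⟨(j : ℕ) + m, by omega⟩)).card ≤ m := by
  set S := Finset.univ.filter fun j : Fin (n - m) =>
    x ∈ Set.Ioc (y ⟨(j : ℕ), by omega⟩) (y ⟨(j : ℕ) + m, by omega⟩) with hS
  rcases S.eq_empty_or_nonempty with h | h
  · simp [h]
  obtain ⟨i, hi, hmin⟩ := S.exists_min_image (fun j => (j : ℕ)) h
  have hsub : S.map Fin.valEmbedding ⊆ Finset.Ico (i : ℕ) (i + m) := by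
    intro k hk
    obtain ⟨j, hj, rfl⟩ := Finset.mem_map.1 hk
    rw [Fin.valEmbedding_apply, Finset.mem_Ico]
    refine ⟨hmin j hj, ?_⟩
    by_contra! hcon
    have h1 : x ≤ y ⟨(i : ℕ) + m, by omega⟩ := (Finset.mem_filter.1 hi).2.2
    have h2 : y ⟨(j : ℕ), by omega⟩ < x := (Finset.mem_filter.1 hj).2.1
    exact absurd (hy (Fin.mk_le_mk.2 hcon)) (not_le.2 (h2.trans_le h1))
  simpa using Finset.card_le_card hsub

/-- Consistency of the average of a power of the spacing density estimates, for a deterministic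
array of samples with asymptotically uniform `μ`-masses of `m`-spacings. -/
theorem tendsto_average_spacingDensity_pow (μ : Measure ℝ) [IsProbabilityMeasure μ]
    (f : ℝ → ℝ) (hf : Measurable f) (M : ℝ) (hf0 : ∀ x, 0 ≤ f x) (hfM : ∀ x, f x ≤ M)
    (hderiv : ∀ᵐ x ∂μ, HasDerivAt (cdf μ) (f x) x) (hpos : ∀ᵐ x ∂μ, 0 < f x)
    (hLip : ∀ a b, a ≤ b → cdf μ b - cdf μ a ≤ M * (b - a))
    (m : ℕ → ℕ) (hm : Tendsto m atTop atTop)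
    (hm_div : Tendsto (fun n : ℕ => (m n : ℝ) / (n : ℝ)) atTop (𝓝 0))
    (x : ∀ n, Fin n → ℝ)
    (hspace : ∀ ε > 0, ∀ᶠ n in atTop, ∀ j : Fin (n - m n),
      |(n : ℝ) / m n * (cdf μ (orderStat (x n) ⟨(j : ℕ) + m n, by omega⟩) -
        cdf μ (orderStat (x n) ⟨(j : ℕ), by omega⟩)) - 1| ≤ ε) (p : ℕ) :
    Tendsto (fun n : ℕ => 1 / ((n : ℝ) - m n) * ∑ j : Fin (n - m n), spacingDensity (m n) (x n) j ^ p)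
      atTop (𝓝 (∫ t, f t ^ p ∂μ)) := by
  have hM : 0 ≤ M := (hf0 0).trans (hfM 0)
  set lo : ∀ n, Fin (n - m n) → ℝ := fun n j => orderStat (x n) ⟨(j : ℕ), by omega⟩ with hlo
  set hi : ∀ n, Fin (n - m n) → ℝ := fun n j => orderStat (x n) ⟨(j : ℕ) + m n, by omega⟩ with hhi
  have hlohi : ∀ n j, lo n j ≤ hi n j := fun n j =>
    monotone_orderStat _ (Fin.mk_le_mk.2 (Nat.le_add_right _ _))
  set d : ∀ n, Fin (n - m n) → ℝ := fun n j => cdf μ (hi n j) - cdf μ (lo n j) with hd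
  have hmass : ∀ n j, μ.real (Set.Ioc (lo n j) (hi n j)) = d n j := by
    intro n j
    conv_lhs => rw [← measure_cdf μ]
    rw [measureReal_def, StieltjesFunction.measure_Ioc,
      ENNReal.toReal_ofReal (sub_nonneg.2 (monotone_cdf μ (hlohi n j)))]
  have hm0 : ∀ᶠ n in atTop, 0 < m n := hm.eventually_gt_atTop 0
  have hmn : ∀ᶠ n in atTop, m n < n := by
    filter_upwards [hm_div.eventually (gt_mem_nhds (zero_lt_one' ℝ)), eventually_gt_atTop 0]
      with n hn h0
    have : (0 : ℝ) < n := by exact_mod_cast h0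
    rw [div_lt_one this] at hn
    exact_mod_cast hn
  have hspace' : ∀ ε > 0, ∀ᶠ n in atTop, ∀ j : Fin (n - m n),
      |d n j - (m n : ℝ) / n| ≤ ε * (m n / n) := by
    intro ε hε
    filter_upwards [hspace ε hε, hm0, hmn] with n hn h0 h1 j
    have hn0 : (0 : ℝ) < n := by exact_mod_cast h0.trans h1
    have hm0 : (0 : ℝ) < m n := by exact_mod_cast h0
    have e : d n j - (m n : ℝ) / n = ((n : ℝ) / m n * d n j - 1) * (m n / n) := by
      field_simp
    rw [e, abs_mul, abs_of_pos (by positivity : (0 : ℝ) < (m n : ℝ) / n)]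
    exact mul_le_mul_of_nonneg_right (hn j) (by positivity)
  have hr : ∀ n j, spacingDensity (m n) (x n) j = (m n : ℝ) / (n + 1) * (hi n j - lo n j)⁻¹ :=
    fun n j => rfl
  -- basic consequences of the uniform spacing bound
  have hbasic : ∀ ε > 0, ε ≤ 1 / 2 → ∀ᶠ n : ℕ in atTop, ∀ j : Fin (n - m n),
      lo n j < hi n j ∧ d n j ≤ 2 * (m n / n) ∧
      0 ≤ spacingDensity (m n) (x n) j ∧ spacingDensity (m n) (x n) j ≤ 2 * M ∧
      |spacingDensity (m n) (x n) j - d n j / (hi n j - lo n j)| ≤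
        2 * M * (1 / ((n : ℝ) + 1) + ε) := by
    intro ε hε hε2
    filter_upwards [hspace' ε hε, hm0, hmn] with n hn h0 h1 j
    have hn0 : (0 : ℝ) < n := by exact_mod_cast h0.trans h1
    have hm0 : (0 : ℝ) < m n := by exact_mod_cast h0
    set q : ℝ := (m n : ℝ) / n with hq
    have hq0 : 0 < q := by positivity
    have hj := abs_le.1 (hn j)
    -- This is where `ε ≤ 1/2` is used: mass at least `q / 2` rules out ties and carries the
    -- Lipschitz bound `M` over to the estimate as `2 * M`.
    have hqd : q ≤ 2 * d n j := by nlinarith [hj.1]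
    have hdpos : 0 < d n j := by linarith
    have hlt : lo n j < hi n j := by
      refine lt_of_le_of_ne (hlohi n j) fun h => ?_
      simp only [hd, h, sub_self, lt_irrefl] at hdpos
    have hpos : 0 < hi n j - lo n j := sub_pos.2 hlt
    have hqn : (m n : ℝ) / (n + 1) ≤ q := by
      rw [hq]; gcongr; linarith
    have hA : d n j * (hi n j - lo n j)⁻¹ ≤ M := by
      rw [← div_eq_mul_inv, div_le_iff₀ hpos]
      exact hLip _ _ hlt.le
    have hinv : 0 < (hi n j - lo n j)⁻¹ := inv_pos.2 hpos
    refine ⟨hlt, by nlinarith [hj.2], by rw [hr]; positivity, ?_, ?_⟩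
    · rw [hr]
      calc _ ≤ 2 * d n j * (hi n j - lo n j)⁻¹ := by gcongr; linarith
        _ ≤ 2 * M := by linarith
    · rw [hr, div_eq_mul_inv (d n j), ← sub_mul, abs_mul, abs_of_pos hinv]
      have e : q - (m n : ℝ) / (n + 1) = q * (1 / ((n : ℝ) + 1)) := by
        rw [hq]; field_simp; ring
      have hb : |(m n : ℝ) / (n + 1) - d n j| ≤ q * (1 / ((n : ℝ) + 1) + ε) := by
        rw [abs_le, mul_add, ← e]
        constructor <;> linarith [hj.1, hj.2]
      have hs : (0 : ℝ) ≤ 1 / ((n : ℝ) + 1) + ε := by positivity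
      calc _ ≤ (2 * d n j) * (1 / ((n : ℝ) + 1) + ε) * (hi n j - lo n j)⁻¹ := by
            gcongr
            exact hb.trans (mul_le_mul_of_nonneg_right hqd hs)
        _ = 2 * (d n j * (hi n j - lo n j)⁻¹) * (1 / ((n : ℝ) + 1) + ε) := by ring
        _ ≤ 2 * M * (1 / ((n : ℝ) + 1) + ε) := by gcongr
  have hlocal : ∀ᵐ t ∂μ, ∀ ε > 0, ∀ᶠ n in atTop, ∀ j, t ∈ Set.Ioc (lo n j) (hi n j) →
      |spacingDensity (m n) (x n) j - f t| < ε := by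
    filter_upwards [hderiv, hpos] with t ht ht0 ε hε
    obtain ⟨δ, hδ, h1⟩ := ht.exists_forall_abs_sub_le (ε := ε / 3) (by positivity)
    obtain ⟨η, hη, h2⟩ := ht.exists_forall_lt_of_sub_lt (monotone_cdf μ) ht0 hδ
    -- The witness has `M + 1` in the denominator because `M = 0` is not excluded here. The final
    -- budget is `ε/3 + ε/4 + ε/4 < ε`.
    obtain ⟨ε', hε', hε'2, hε'3⟩ : ∃ ε' > 0, ε' ≤ 1 / 2 ∧ 2 * M * ε' ≤ ε / 4 := by
      refine ⟨min (1 / 2) (ε / (8 * (M + 1))), by positivity, min_le_left _ _, ?_⟩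
      calc 2 * M * min (1 / 2) (ε / (8 * (M + 1))) ≤ 2 * (M + 1) * (ε / (8 * (M + 1))) := by
            gcongr
            · linarith
            · exact min_le_right _ _
        _ = ε / 4 := by field_simp; ring
    have hsmall : Tendsto (fun n : ℕ => 2 * M * (1 / ((n : ℝ) + 1))) atTop (𝓝 0) := by
      simpa using (tendsto_one_div_add_atTop_nhds_zero_nat (𝕜 := ℝ)).const_mul (2 * M)
    filter_upwards [hbasic ε' hε' hε'2, hm_div.eventually (gt_mem_nhds (half_pos hη)),
      hsmall.eventually (gt_mem_nhds (by positivity : (0 : ℝ) < ε / 4))] with n hn hmn hns j hj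
    obtain ⟨hlt, hd2, -, -, hdiff⟩ := hn j
    -- Small mass forces a short interval because the derivative at `t` is positive.
    obtain ⟨hl, hh⟩ := h2 _ _ hj.1.le hj.2 (show d n j < η by linarith)
    have h3 := h1 _ _ hj.1.le hj.2 hl hh
    have hpos : 0 < hi n j - lo n j := sub_pos.2 hlt
    have h4 : |d n j / (hi n j - lo n j) - f t| ≤ ε / 3 := by
      have e : d n j / (hi n j - lo n j) - f t =
          (d n j - f t * (hi n j - lo n j)) / (hi n j - lo n j) := by field_simp
      rw [e, abs_div, abs_of_pos hpos, div_le_iff₀ hpos]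
      exact h3
    rw [abs_le] at h4 hdiff
    rw [abs_lt]
    constructor <;> linarith [h4.1, h4.2, hdiff.1, hdiff.2]
  have main := tendsto_average_of_local_tendsto μ (fun n => n - m n) m
    (fun n j => Set.Ioc (lo n j) (hi n j)) (fun n j => measurableSet_Ioc)
    (fun n j => spacingDensity (m n) (x n) j ^ p) (fun t => f t ^ p) (hf.pow_const p)
    ((2 * M) ^ p) ?_ ?_ ?_ ?_ ?_ ?_
  · refine main.congr' ?_
    filter_upwards [hmn] with n hn
    rw [Nat.cast_sub hn.le]
  · intro t
    rw [abs_of_nonneg (pow_nonneg (hf0 t) p)]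
    exact pow_le_pow_left₀ (hf0 t) (by linarith [hfM t]) p
  · filter_upwards [hmn] with n hn using Nat.sub_pos_of_lt hn
  · intro n t
    convert card_filter_mem_Ioc_spacing_le (m := m n) (monotone_orderStat (x n)) t
  · filter_upwards [hbasic (1 / 2) (by norm_num) le_rfl] with n hn j
    obtain ⟨-, -, h0, h1, -⟩ := hn j
    rw [abs_of_nonneg (pow_nonneg h0 p)]
    exact pow_le_pow_left₀ h0 h1 p
  · filter_upwards [hlocal] with t ht ε hε
    obtain ⟨δ, hδ, h⟩ := Metric.continuousAt_iff.1
      ((continuous_pow (M := ℝ) p).continuousAt (x := f t)) ε hε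
    filter_upwards [ht δ hδ] with n hn j hj
    exact (h (show dist (spacingDensity (m n) (x n) j) (f t) < δ from hn j hj)).le
  · rw [Metric.tendsto_nhds]
    intro ε hε
    filter_upwards [hspace' (ε / 3) (by positivity),
      hm_div.eventually (gt_mem_nhds (by positivity : (0 : ℝ) < ε / 3)), hm0, hmn]
      with n hn hq h0 h1
    have hn0 : (0 : ℝ) < n := by exact_mod_cast h0.trans h1
    have hm0 : (0 : ℝ) < m n := by exact_mod_cast h0
    have hnm : (0 : ℝ) < n - m n := sub_pos.2 (by exact_mod_cast h1)
    rw [dist_zero_right, Real.norm_eq_abs,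
      abs_of_nonneg (Finset.sum_nonneg fun j _ => abs_nonneg _)]
    have hterm : ∀ j : Fin (n - m n),
        |1 / ((n - m n : ℕ) : ℝ) - μ.real (Set.Ioc (lo n j) (hi n j)) / m n| ≤
        (m n : ℝ) / (n * (n - m n)) + ε / 3 / n := by
      intro j
      rw [hmass, Nat.cast_sub h1.le]
      -- The first term is `1/(n-m) - 1/n`; summed over the `n - m` indices it contributes `m/n`.
      have e : 1 / ((n : ℝ) - m n) - d n j / m n =
          (m n : ℝ) / (n * (n - m n)) - (d n j - m n / n) / m n := by
        field_simp
        ring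
      rw [e]
      refine (abs_sub _ _).trans (add_le_add ?_ ?_)
      · rw [abs_of_nonneg (by positivity)]
      · rw [abs_div, abs_of_pos hm0, div_le_iff₀ hm0]
        refine (hn j).trans_eq ?_
        field_simp
    calc _ ≤ ∑ j : Fin (n - m n), ((m n : ℝ) / (n * (n - m n)) + ε / 3 / n) :=
          Finset.sum_le_sum fun j _ => hterm j
      _ = m n / n + ε / 3 * ((n - m n) / n) := by
          simp only [Finset.sum_const, Finset.card_univ, Fintype.card_fin, nsmul_eq_mul]
          rw [Nat.cast_sub h1.le]
          field_simp
      _ ≤ m n / n + ε / 3 * 1 := by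
          gcongr
          rw [div_le_one hn0]
          linarith
      _ < ε := by linarith

/-! ### Chernoff bound -/

open Classical in
/-- Chernoff bounds for the number of hits of a set by independent trials with the same success
probability. -/
theorem measureReal_card_filter_mem_le_exp {Ω ι α : Type*} [MeasurableSpace Ω] [MeasurableSpace α]
    [Fintype ι] {P : Measure Ω} [IsProbabilityMeasure P] {X : ι → Ω → α}
    (hX : ∀ i, Measurable (X i)) (hindep : iIndepFun X P) {A : Set α} (hA : MeasurableSet A)
    {p : ℝ} (hp : ∀ i, P.real (X i ⁻¹' A) = p) {ε : ℝ} (hε0 : 0 ≤ ε) (hε1 : ε ≤ 1) :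
    P.real {ω | ¬ |((Finset.univ.filter fun i => X i ω ∈ A).card : ℝ) - Fintype.card ι * p| ≤
      ε * (Fintype.card ι * p)} ≤ 2 * Real.exp (-(Fintype.card ι * p * ε ^ 2 / 4)) := by
  set N : ℝ := ((Fintype.card ι : ℕ) : ℝ) with hN
  set B : ι → Ω → ℝ := fun i => (A.indicator fun _ => (1 : ℝ)) ∘ X i with hB
  have hg : Measurable (A.indicator fun _ => (1 : ℝ)) := measurable_const.indicator hA
  have hBm : ∀ i, Measurable (B i) := fun i => hg.comp (hX i)
  have hBi : iIndepFun B P := hindep.comp (fun _ => A.indicator fun _ => (1 : ℝ)) fun _ => hg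
  have hS : ∀ ω, (∑ i, B i) ω = ((Finset.univ.filter fun i => X i ω ∈ A).card : ℝ) := by
    intro ω
    simp [hB, Finset.sum_apply, Set.indicator_apply]
  have hp0 : 0 ≤ N * p := by
    rw [hN]
    rcases isEmpty_or_nonempty ι with h | ⟨⟨i⟩⟩
    · simp
    · rw [← hp i]; positivity
  have hmgf1 : ∀ i t, mgf (B i) P t = 1 + p * (Real.exp t - 1) := by
    intro i t
    have e : (fun ω => Real.exp (t * B i ω)) =
        fun ω => 1 + (X i ⁻¹' A).indicator (fun _ => Real.exp t - 1) ω := by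
      ext ω
      by_cases h : X i ω ∈ A
      · simp [hB, h]
      · simp [hB, h]
    rw [mgf, e, integral_add (integrable_const _)
      ((integrable_const _).indicator (hX i hA)), integral_indicator (hX i hA)]
    simp [hp]
  have hmgf : ∀ t, mgf (∑ i, B i) P t ≤ Real.exp (N * p * (Real.exp t - 1)) := by
    intro t
    rw [hBi.mgf_sum hBm]
    calc ∏ i, mgf (B i) P t ≤ ∏ _i : ι, Real.exp (p * (Real.exp t - 1)) := by
          refine Finset.prod_le_prod (fun i _ => mgf_nonneg) fun i _ => ?_
          rw [hmgf1, add_comm]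
          exact Real.add_one_le_exp _
      _ = _ := by
          rw [Finset.prod_const, ← Real.exp_nat_mul, Finset.card_univ, mul_assoc]
  have hint : ∀ t, Integrable (fun ω => Real.exp (t * (∑ i, B i) ω)) P := by
    intro t
    refine Integrable.of_bound (C := Real.exp (|t| * Fintype.card ι)) ?_ (ae_of_all _ fun ω => ?_)
    · have : Measurable (∑ i, B i) := by fun_prop
      exact (this.const_mul t).exp.aestronglyMeasurable
    · rw [Real.norm_eq_abs, Real.abs_exp, hS]
      refine Real.exp_le_exp.2 ((le_abs_self _).trans ?_)
      rw [abs_mul, Nat.abs_cast]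
      gcongr
      exact Finset.card_le_univ _
  have hexp : ∀ t, |t| ≤ 1 → Real.exp t - 1 ≤ t + t ^ 2 := fun t ht => by
    linarith [(abs_le.1 (Real.abs_exp_sub_one_sub_id_le ht)).2]
  -- With `e^t - 1 ≤ t + t²` the exponent is at most `N p (t² - ε |t|)` in both tails; `t = ±ε/2`
  -- minimises it, at `-N p ε² / 4`.
  have hupper : P.real {ω | (1 + ε) * (N * p) ≤ (∑ i, B i) ω} ≤
      Real.exp (-(N * p * ε ^ 2 / 4)) := by
    refine (measure_ge_le_exp_mul_mgf _ (by linarith) (hint (ε / 2))).trans ?_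
    refine (mul_le_mul_of_nonneg_left (hmgf _) (Real.exp_nonneg _)).trans ?_
    rw [← Real.exp_add, Real.exp_le_exp]
    nlinarith [mul_le_mul_of_nonneg_left (hexp (ε / 2) (by rw [abs_le]; constructor <;> linarith))
      hp0]
  have hlower : P.real {ω | (∑ i, B i) ω ≤ (1 - ε) * (N * p)} ≤
      Real.exp (-(N * p * ε ^ 2 / 4)) := by
    refine (measure_le_le_exp_mul_mgf _ (by linarith) (hint (-(ε / 2)))).trans ?_
    refine (mul_le_mul_of_nonneg_left (hmgf _) (Real.exp_nonneg _)).trans ?_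
    rw [← Real.exp_add, Real.exp_le_exp]
    nlinarith [mul_le_mul_of_nonneg_left
      (hexp (-(ε / 2)) (by rw [abs_le]; constructor <;> linarith)) hp0]
  have hsub : {ω | ¬ |((Finset.univ.filter fun i => X i ω ∈ A).card : ℝ) - N * p| ≤
      ε * (N * p)} ⊆ {ω | (1 + ε) * (N * p) ≤ (∑ i, B i) ω} ∪
        {ω | (∑ i, B i) ω ≤ (1 - ε) * (N * p)} := by
    intro ω hω
    simp only [Set.mem_union, Set.mem_ofPred_eq, hS] at hω ⊢
    by_contra! hcon
    refine hω (abs_le.2 ⟨?_, ?_⟩) <;> linarith [hcon.1, hcon.2]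
  calc _ ≤ _ := measureReal_mono hsub
    _ ≤ _ := measureReal_union_le _ _
    _ ≤ _ := by linarith

/-! ### From cell counts to spacings -/

/-- The number of sample points whose image under `⌊K · v⌋` is `k`. -/
noncomputable def cellCount {n : ℕ} (K : ℕ) (v : Fin n → ℝ) (k : ℕ) : ℕ :=
  (Finset.univ.filter fun i => ⌊(K : ℝ) * v i⌋₊ = k).card

theorem cellCount_comp_perm {n : ℕ} (K : ℕ) (v : Fin n → ℝ) (σ : Equiv.Perm (Fin n)) (k : ℕ) :
    cellCount K (v ∘ σ) k = cellCount K v k := by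
  unfold cellCount
  refine Finset.card_equiv σ fun i => ?_
  simp

/-- If the cells `[k / K, (k + 1) / K)` contain nearly the expected numbers of points of a sorted
sample of `[0, 1)`, then all its `m`-spacings are nearly `m / n`. -/
theorem abs_spacing_sub_one_le_of_cellCount {n m K L : ℕ} (hL : 2 ≤ L) (hm : 0 < m)
    (hLm : L * n ≤ 2 * (m * K)) (hmL : m * K ≤ L * n) {w : Fin n → ℝ} (hw : Monotone w)
    (hw0 : ∀ i, 0 ≤ w i) (hw1 : ∀ i, w i < 1)
    (hcell : ∀ k < K, |(cellCount K w k : ℝ) - n * (K : ℝ)⁻¹| ≤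
      (L : ℝ)⁻¹ * (n * (K : ℝ)⁻¹)) (j : Fin (n - m)) :
    |(n : ℝ) / m * (w ⟨(j : ℕ) + m, by omega⟩ - w ⟨(j : ℕ), by omega⟩) - 1| ≤ 6 / L := by
  set a : Fin n := ⟨(j : ℕ), by omega⟩ with ha
  set b : Fin n := ⟨(j : ℕ) + m, by omega⟩ with hb
  have hn0 : 0 < n := a.pos
  have hK : 0 < K := by
    rcases Nat.eq_zero_or_pos K with h | h
    · subst h; nlinarith
    · exact h
  have hKR : (0 : ℝ) < K := by exact_mod_cast hK
  have hnR : (0 : ℝ) < n := by exact_mod_cast hn0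
  have hmR : (0 : ℝ) < m := by exact_mod_cast hm
  have hLR : (2 : ℝ) ≤ L := by exact_mod_cast hL
  set c : Fin n → ℕ := fun i => ⌊(K : ℝ) * w i⌋₊ with hc
  have hcmono : Monotone c := fun i i' h =>
    Nat.floor_mono (mul_le_mul_of_nonneg_left (hw h) hKR.le)
  have hcK : ∀ i, c i < K := fun i => by
    rw [hc, Nat.floor_lt (by have := hw0 i; positivity)]
    nlinarith [hw1 i]
  have hab : c a ≤ c b := hcmono (Fin.mk_le_mk.2 (by omega))
  set u : ℝ := n * (K : ℝ)⁻¹ with hu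
  have hu0 : 0 < u := by positivity
  have hsum : ∀ s : Finset ℕ, ((Finset.univ.filter fun i => c i ∈ s).card : ℝ) =
      ∑ k ∈ s, (cellCount K w k : ℝ) := by
    intro s
    rw [Finset.card_eq_sum_card_fiberwise (f := c) (t := s) (fun i hi => by simpa using hi)]
    push_cast
    refine Finset.sum_congr rfl fun k hk => ?_
    unfold cellCount
    congr 2
    ext i
    simp only [Finset.mem_filter, Finset.mem_univ, true_and, hc]
    constructor
    · exact fun h => h.2
    · exact fun h => ⟨by rwa [h], h⟩
  -- cells strictly between
  have h1 : ((c b : ℝ) - c a - 1) * ((1 - (L : ℝ)⁻¹) * u) ≤ m := by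
    have hcard : ((Finset.univ.filter fun i => c i ∈ Finset.Ioo (c a) (c b)).card : ℝ) ≤ m := by
      have hsub : (Finset.univ.filter fun i => c i ∈ Finset.Ioo (c a) (c b)) ⊆
          Finset.Ioc a b := by
        intro i hi
        simp only [Finset.mem_filter, Finset.mem_univ, true_and, Finset.mem_Ioo] at hi
        exact Finset.mem_Ioc.2 ⟨hcmono.reflect_lt hi.1, (hcmono.reflect_lt hi.2).le⟩
      have := Finset.card_le_card hsub
      rw [Fin.card_Ioc] at this
      have h' : (b : ℕ) - (a : ℕ) = m := by simp [ha, hb]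
      rw [h'] at this
      exact_mod_cast this
    have hlow : ∑ k ∈ Finset.Ioo (c a) (c b), (1 - (L : ℝ)⁻¹) * u ≤
        ∑ k ∈ Finset.Ioo (c a) (c b), (cellCount K w k : ℝ) := by
      refine Finset.sum_le_sum fun k hk => ?_
      have := (abs_le.1 (hcell k ((Finset.mem_Ioo.1 hk).2.trans (hcK b)))).1
      linarith
    rw [← hsum, Finset.sum_const, Nat.card_Ioo, nsmul_eq_mul] at hlow
    refine le_trans (mul_le_mul_of_nonneg_right ?_ ?_) (hlow.trans hcard)
    -- Truncated subtraction: for `c a = c b` the count is `0` while the real factor is `-1`.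
    · have : c b ≤ (c b - c a - 1) + c a + 1 := by omega
      have : (c b : ℝ) ≤ ((c b - c a - 1 : ℕ) : ℝ) + c a + 1 := by exact_mod_cast this
      linarith
    · have : (L : ℝ)⁻¹ ≤ 1 := inv_le_one_of_one_le₀ (by linarith)
      exact mul_nonneg (by linarith) hu0.le
  have h2 : (m : ℝ) ≤ ((c b : ℝ) - c a + 1) * ((1 + (L : ℝ)⁻¹) * u) := by
    have hcard : (m : ℝ) ≤
        ((Finset.univ.filter fun i => c i ∈ Finset.Icc (c a) (c b)).card : ℝ) := by
      have hsub : Finset.Ioc a b ⊆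
          (Finset.univ.filter fun i => c i ∈ Finset.Icc (c a) (c b)) := by
        intro i hi
        simp only [Finset.mem_filter, Finset.mem_univ, true_and, Finset.mem_Icc]
        exact ⟨hcmono (Finset.mem_Ioc.1 hi).1.le, hcmono (Finset.mem_Ioc.1 hi).2⟩
      have := Finset.card_le_card hsub
      rw [Fin.card_Ioc] at this
      have h' : (b : ℕ) - (a : ℕ) = m := by simp [ha, hb]
      rw [h'] at this
      exact_mod_cast this
    have hupp : ∑ k ∈ Finset.Icc (c a) (c b), (cellCount K w k : ℝ) ≤
        ∑ k ∈ Finset.Icc (c a) (c b), (1 + (L : ℝ)⁻¹) * u := by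
      refine Finset.sum_le_sum fun k hk => ?_
      have := (abs_le.1 (hcell k ((Finset.mem_Icc.1 hk).2.trans_lt (hcK b)))).2
      linarith
    rw [← hsum, Finset.sum_const, Nat.card_Icc, nsmul_eq_mul] at hupp
    refine (hcard.trans hupp).trans_eq ?_
    rw [Nat.cast_sub (by omega)]
    push_cast
    ring
  have hfa := Nat.floor_le (show 0 ≤ (K : ℝ) * w a from mul_nonneg hKR.le (hw0 a))
  have hfb := Nat.floor_le (show 0 ≤ (K : ℝ) * w b from mul_nonneg hKR.le (hw0 b))
  have hfa' := Nat.lt_floor_add_one ((K : ℝ) * w a)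
  have hfb' := Nat.lt_floor_add_one ((K : ℝ) * w b)
  set r : ℝ := (c b : ℝ) - c a with hr
  set q : ℝ := u / m with hq
  have hq0 : 0 < q := by positivity
  have hqL : 1 / (L : ℝ) ≤ q := by
    rw [hq, hu, ← div_eq_mul_inv, div_div, div_le_div_iff₀ (by linarith) (by positivity)]
    have : ((m * K : ℕ) : ℝ) ≤ ((L * n : ℕ) : ℝ) := by exact_mod_cast hmL
    push_cast at this
    linarith
  have hqL' : q ≤ 2 / (L : ℝ) := by
    rw [hq, hu, ← div_eq_mul_inv, div_div, div_le_div_iff₀ (by positivity) (by linarith)]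
    have : ((L * n : ℕ) : ℝ) ≤ ((2 * (m * K) : ℕ) : ℝ) := by exact_mod_cast hLm
    push_cast at this
    linarith
  have hD : (n : ℝ) / m * (w b - w a) = (K * w b - K * w a) * q := by
    rw [hq, hu]; field_simp
  have hD1 : (n : ℝ) / m * (w b - w a) ≤ (r + 1) * q := by
    rw [hD]
    refine mul_le_mul_of_nonneg_right ?_ hq0.le
    simp only [hr, hc]; linarith
  have hD2 : (r - 1) * q ≤ (n : ℝ) / m * (w b - w a) := by
    rw [hD]
    refine mul_le_mul_of_nonneg_right ?_ hq0.le
    simp only [hr, hc]; linarith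
  have h1' : (r - 1) * q * (1 - (L : ℝ)⁻¹) ≤ 1 := by
    have : (r - 1) * q * (1 - (L : ℝ)⁻¹) = (r - 1) * ((1 - (L : ℝ)⁻¹) * u) / m := by
      rw [hq]; ring
    rw [this, div_le_one hmR]
    exact h1
  have h2' : 1 ≤ (r + 1) * q * (1 + (L : ℝ)⁻¹) := by
    have : (r + 1) * q * (1 + (L : ℝ)⁻¹) = (r + 1) * ((1 + (L : ℝ)⁻¹) * u) / m := by
      rw [hq]; ring
    rw [this, le_div_iff₀ hmR, one_mul]
    exact h2
  have hl0 : 0 < (L : ℝ)⁻¹ := by positivity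
  have hl1 : (L : ℝ)⁻¹ ≤ 1 / 2 := by
    rw [one_div]; exact inv_anti₀ (by norm_num) hLR
  rw [div_eq_mul_inv] at hqL'
  rw [div_eq_mul_inv (6 : ℝ)]
  rw [one_div] at hqL
  set l := (L : ℝ)⁻¹ with hl
  -- `(1 + 2l)(1 - l) ≥ 1` for `l ≤ 1/2`, which is why `2 ≤ L` is required.
  have h3 : (r - 1) * q ≤ 1 + 2 * l := by
    by_contra! hcon
    nlinarith
  have h4 : 1 - l ≤ (r + 1) * q := by
    by_contra! hcon
    nlinarith
  -- The scaled spacing lies between `(r - 1) q` and `(r + 1) q`, which differ by `2q ≤ 4l`; with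
  -- the `2l` of `h3` this makes `6l`.
  rw [abs_le]
  constructor <;> linarith

/-! ### Uniformity of the transformed sample -/

/-- The probability integral transform: a continuous cdf is uniformly distributed. -/
theorem measureReal_cdf_lt_of_continuous (μ : Measure ℝ) [IsProbabilityMeasure μ]
    (hc : Continuous (cdf μ)) {u : ℝ} (hu0 : 0 ≤ u) (hu1 : u ≤ 1) :
    μ.real {x | cdf μ x < u} = u := by
  have hIio : ∀ t, μ.real (Set.Iio t) = cdf μ t := by
    intro t
    conv_lhs => rw [← measure_cdf μ]
    rw [measureReal_def, StieltjesFunction.measure_Iio _ (tendsto_cdf_atBot μ),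
      (monotone_cdf μ).continuousWithinAt_Iio_iff_leftLim_eq.1 hc.continuousWithinAt, sub_zero,
      ENNReal.toReal_ofReal (cdf_nonneg μ t)]
  have hmid : ∀ u, 0 < u → u < 1 → μ.real {x | cdf μ x < u} = u := by
    intro u h0 h1
    obtain ⟨t, ht⟩ : ∃ t, cdf μ t = u := by
      obtain ⟨a, ha⟩ := ((tendsto_cdf_atBot μ).eventually (gt_mem_nhds h0)).exists
      obtain ⟨b, hb⟩ := ((tendsto_cdf_atTop μ).eventually (lt_mem_nhds h1)).exists
      exact mem_range_of_exists_le_of_exists_ge hc ⟨a, ha.le⟩ ⟨b, hb.le⟩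
    obtain ⟨a, ha⟩ := ((tendsto_cdf_atBot μ).eventually (gt_mem_nhds h0)).exists
    set S := {x | u ≤ cdf μ x} with hS
    have hbdd : BddBelow S :=
      ⟨a, fun x hx => le_of_lt ((monotone_cdf μ).reflect_lt (ha.trans_le hx))⟩
    have hmem : sInf S ∈ S :=
      (isClosed_le continuous_const hc).csInf_mem ⟨t, ht.ge⟩ hbdd
    have heq : {x | cdf μ x < u} = Set.Iio (sInf S) := by
      ext x
      constructor
      · exact fun hx => (monotone_cdf μ).reflect_lt (lt_of_lt_of_le hx hmem)
      · intro hx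
        by_contra hcon
        have hxS : x ∈ S := not_lt.1 fun h : cdf μ x < u => hcon h
        exact absurd (csInf_le hbdd hxS) (not_le.2 hx)
    rw [heq, hIio]
    refine le_antisymm ?_ hmem
    rw [← ht]
    exact monotone_cdf μ (csInf_le hbdd ht.ge)
  rcases hu0.eq_or_lt with rfl | h0
  · have : {x | cdf μ x < 0} = ∅ := by
      ext x; simpa using cdf_nonneg μ x
    simp [this]
  rcases hu1.eq_or_lt with rfl | h1
  -- The cdf need not attain the value `1`, so this endpoint is approached from below.
  · refine le_antisymm measureReal_le_one (le_of_forall_pos_sub_le fun ε hε => ?_)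
    set ε' := min ε (1 / 2)
    have h1 : ε' ≤ ε := min_le_left _ _
    have h2 : ε' ≤ 1 / 2 := min_le_right _ _
    have h3 : 0 < ε' := lt_min hε (by norm_num)
    calc 1 - ε ≤ 1 - ε' := by linarith
      _ = μ.real {x | cdf μ x < 1 - ε'} := (hmid _ (by linarith) (by linarith)).symm
      _ ≤ μ.real {x | cdf μ x < 1} :=
        measureReal_mono fun x (hx : cdf μ x < 1 - ε') => show cdf μ x < 1 by linarith
  · exact hmid u h0 h1

theorem measureReal_floor_mul_cdf_eq (μ : Measure ℝ) [IsProbabilityMeasure μ]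
    (hc : Continuous (cdf μ)) {K k : ℕ} (hk : k < K) :
    μ.real {x | ⌊(K : ℝ) * cdf μ x⌋₊ = k} = (K : ℝ)⁻¹ := by
  have hK : (0 : ℝ) < K := by exact_mod_cast (Nat.zero_le k).trans_lt hk
  have hkK : (k : ℝ) + 1 ≤ K := by exact_mod_cast hk
  have hset : {x | ⌊(K : ℝ) * cdf μ x⌋₊ = k} =
      {x | cdf μ x < ((k : ℝ) + 1) / K} \ {x | cdf μ x < (k : ℝ) / K} := by
    ext x
    simp only [Set.mem_ofPred_eq, Set.mem_sdiff, not_lt]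
    rw [Nat.floor_eq_iff (mul_nonneg hK.le (cdf_nonneg μ x)), lt_div_iff₀ hK, div_le_iff₀ hK,
      mul_comm, and_comm]
  have hmeas : MeasurableSet {x | cdf μ x < (k : ℝ) / K} :=
    (isOpen_lt hc continuous_const).measurableSet
  rw [hset, measureReal_sdiff _ hmeas,
    measureReal_cdf_lt_of_continuous μ hc (by positivity) (by rwa [div_le_one hK]),
    measureReal_cdf_lt_of_continuous μ hc (by positivity) (by rw [div_le_one hK]; linarith)]
  · field_simp; ring
  · intro x (hx : cdf μ x < _)
    refine lt_of_lt_of_le hx ?_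
    gcongr
    linarith

/-! ### Almost sure uniformity of the spacings -/

/-- Almost surely, all cells eventually contain nearly the expected numbers of points. -/
theorem ae_eventually_abs_cellCount_sub_le {Ω : Type*} [MeasurableSpace Ω] (P : Measure Ω)
    [IsProbabilityMeasure P] (X : ℕ → Ω → ℝ) (hX : ∀ i, Measurable (X i)) (hindep : iIndepFun X P)
    (μ : Measure ℝ) [IsProbabilityMeasure μ] (hlaw : ∀ i, P.map (X i) = μ)
    (hc : Continuous (cdf μ)) (m : ℕ → ℕ) (hm : Tendsto m atTop atTop)
    (hm_log : Tendsto (fun n : ℕ => (m n : ℝ) / Real.log (n : ℝ)) atTop atTop)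
    {L : ℕ} (hL : 0 < L) :
    ∀ᵐ ω ∂P, ∀ᶠ n in atTop, ∀ k < L * n / m n,
      |(cellCount (L * n / m n) (fun i : Fin n => cdf μ (X i ω)) k : ℝ) -
        n * ((L * n / m n : ℕ) : ℝ)⁻¹| ≤ (L : ℝ)⁻¹ * (n * ((L * n / m n : ℕ) : ℝ)⁻¹) := by
  set K : ℕ → ℕ := fun n => L * n / m n with hK
  set bad : ℕ → ℕ → Set Ω := fun n k =>
    {ω | ¬ |(cellCount (K n) (fun i : Fin n => cdf μ (X i ω)) k : ℝ) - n * (K n : ℝ)⁻¹| ≤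
      (L : ℝ)⁻¹ * (n * (K n : ℝ)⁻¹)} with hbad
  have hLR : (1 : ℝ) ≤ L := by exact_mod_cast hL
  have hchernoff : ∀ n, ∀ k < K n, P.real (bad n k) ≤
      2 * Real.exp (-(n * (K n : ℝ)⁻¹ * (L : ℝ)⁻¹ ^ 2 / 4)) := by
    intro n k hk
    have hA : MeasurableSet {x | ⌊(K n : ℝ) * cdf μ x⌋₊ = k} :=
      (Nat.measurable_floor.comp (measurable_const.mul hc.measurable)) (measurableSet_singleton k)
    have := measureReal_card_filter_mem_le_exp (P := P) (X := fun i : Fin n => X i)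
      (fun i => hX i) (hindep.precomp Fin.val_injective) hA (p := (K n : ℝ)⁻¹)
      (fun i => by
        rw [← measureReal_floor_mul_cdf_eq μ hc hk, ← hlaw i,
          map_measureReal_apply (hX i) (by rw [hlaw i]; exact hA)])
      (ε := (L : ℝ)⁻¹) (by positivity) (inv_le_one_of_one_le₀ hLR)
    rw [Fintype.card_fin] at this
    convert this using 6
    simp only [cellCount, Set.mem_ofPred_eq]
  have hsum : Summable fun n => P.real (⋃ k ∈ Finset.range (K n), bad n k) := by
    have hs : Summable fun n : ℕ => 2 * (1 / (n : ℝ) ^ 2) :=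
      (Real.summable_one_div_nat_pow.2 one_lt_two).mul_left 2
    refine Summable.of_norm_bounded_eventually_nat hs ?_
    -- Since `n / K ≥ m / L`, the Chernoff exponent is at least `m / (4 L³)`. The threshold `12 L³`
    -- makes it at least `3 log n`, so each cell fails with probability at most `2 / n³`; `L ≤ m`
    -- gives at most `n` cells, and `2 / n²` is summable.
    filter_upwards [hm_log.eventually_ge_atTop (12 * (L : ℝ) ^ 3), hm.eventually_ge_atTop L,
      eventually_gt_atTop 1] with n hlog hLm hn1
    have hn0 : (0 : ℝ) < n := by positivity
    have hlog0 : 0 < Real.log n := Real.log_pos (by exact_mod_cast hn1)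
    have hKn : K n ≤ n := Nat.div_le_of_le_mul (Nat.mul_le_mul_right n hLm)
    rw [Real.norm_eq_abs, abs_of_nonneg measureReal_nonneg]
    calc _ ≤ ∑ k ∈ Finset.range (K n), P.real (bad n k) := measureReal_biUnion_finset_le _ _
      _ ≤ ∑ k ∈ Finset.range (K n), 2 * (1 / (n : ℝ) ^ 3) := by
        refine Finset.sum_le_sum fun k hk => ?_
        have hk' := Finset.mem_range.1 hk
        have hK0 : (0 : ℝ) < K n := by exact_mod_cast (Nat.zero_le k).trans_lt hk'
        refine (hchernoff n k hk').trans ?_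
        have hmK : (m n : ℝ) * K n ≤ L * n := by exact_mod_cast Nat.mul_div_le (L * n) (m n)
        have h1 : (m n : ℝ) * (L : ℝ)⁻¹ ≤ n * (K n : ℝ)⁻¹ := by
          rw [← div_eq_mul_inv, ← div_eq_mul_inv, div_le_div_iff₀ (by linarith) hK0]
          linarith
        have h2 : 3 * Real.log n ≤ n * (K n : ℝ)⁻¹ * (L : ℝ)⁻¹ ^ 2 / 4 := by
          rw [le_div_iff₀ hlog0] at hlog
          calc 3 * Real.log n = (12 * (L : ℝ) ^ 3 * Real.log n) * (L : ℝ)⁻¹ * (L : ℝ)⁻¹ ^ 2 / 4 := by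
                field_simp; ring
            _ ≤ m n * (L : ℝ)⁻¹ * (L : ℝ)⁻¹ ^ 2 / 4 := by gcongr
            _ ≤ _ := by gcongr
        have h3 : Real.exp (-(3 * Real.log n)) = 1 / (n : ℝ) ^ 3 := by
          rw [Real.exp_neg, one_div, mul_comm, Real.exp_mul, Real.exp_log hn0]
          norm_cast
        rw [← h3]
        gcongr
      _ = K n * (2 * (1 / (n : ℝ) ^ 3)) := by simp
      _ ≤ n * (2 * (1 / (n : ℝ) ^ 3)) := by gcongr
      _ = 2 * (1 / (n : ℝ) ^ 2) := by field_simp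
  have hne : ∑' n, P (⋃ k ∈ Finset.range (K n), bad n k) ≠ ⊤ := by
    have := hsum.tsum_ofReal_ne_top
    simpa [ofReal_measureReal] using this
  filter_upwards [ae_eventually_notMem hne] with ω hω
  filter_upwards [hω] with n hn k hk
  by_contra hcon
  exact hn (Set.mem_biUnion (Finset.mem_coe.2 (Finset.mem_range.2 hk)) hcon)

/-- Almost surely, the `μ`-masses of all `m`-spacings of a sample from `μ` are uniformly close
to `m / n`. -/
theorem ae_eventually_abs_spacing_sub_one_le {Ω : Type*} [MeasurableSpace Ω] (P : Measure Ω)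
    [IsProbabilityMeasure P] (X : ℕ → Ω → ℝ) (hX : ∀ i, Measurable (X i)) (hindep : iIndepFun X P)
    (μ : Measure ℝ) [IsProbabilityMeasure μ] (hlaw : ∀ i, P.map (X i) = μ)
    (hc : Continuous (cdf μ)) (m : ℕ → ℕ) (hm : Tendsto m atTop atTop)
    (hm_log : Tendsto (fun n : ℕ => (m n : ℝ) / Real.log (n : ℝ)) atTop atTop)
    (hm_div : Tendsto (fun n : ℕ => (m n : ℝ) / (n : ℝ)) atTop (𝓝 0)) :
    ∀ᵐ ω ∂P, ∀ ε > 0, ∀ᶠ n in atTop, ∀ j : Fin (n - m n),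
      |(n : ℝ) / m n *
        (cdf μ (orderStat (fun i : Fin n => X i ω) ⟨(j : ℕ) + m n, by omega⟩) -
        cdf μ (orderStat (fun i : Fin n => X i ω) ⟨(j : ℕ), by omega⟩)) - 1| ≤ ε := by
  -- A sample point with cdf value `1` would fall into none of the cells `k < K`.
  have hlt : ∀ᵐ ω ∂P, ∀ i, cdf μ (X i ω) < 1 := by
    rw [ae_all_iff]
    intro i
    have hmeas : MeasurableSet {x | cdf μ x < 1} := (isOpen_lt hc continuous_const).measurableSet
    have h : ∀ᵐ x ∂μ, cdf μ x < 1 := by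
      refine (mem_ae_iff_prob_eq_one hmeas).2 ?_
      rw [← ENNReal.toReal_eq_one_iff]
      exact measureReal_cdf_lt_of_continuous μ hc zero_le_one le_rfl
    have hq : Measure.QuasiMeasurePreserving (X i) P μ := ⟨hX i, (hlaw i).absolutelyContinuous⟩
    exact hq.ae h
  have hcells : ∀ᵐ ω ∂P, ∀ L : ℕ, _ := ae_all_iff.2 fun L : ℕ =>
    ae_eventually_abs_cellCount_sub_le P X hX hindep μ hlaw hc m hm hm_log (Nat.succ_pos L)
  filter_upwards [hlt, hcells] with ω hω1 hω ε hε
  obtain ⟨L, hLε⟩ := exists_nat_gt (6 / ε)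
  -- The double shift makes the cell parameter at least `2`.
  have hL' : 6 / (((L + 1).succ : ℕ) : ℝ) ≤ ε := by
    rw [div_lt_iff₀ hε] at hLε
    rw [div_le_iff₀ (by positivity)]
    push_cast
    nlinarith
  filter_upwards [hω (L + 1), hm.eventually_gt_atTop 0,
    hm_div.eventually (gt_mem_nhds (zero_lt_one' ℝ)), eventually_gt_atTop 0] with n hn hm0 hmn hn0 j
  have hmn' : m n < n := by
    have : (0 : ℝ) < n := by exact_mod_cast hn0
    rw [div_lt_one this] at hmn
    exact_mod_cast hmn
  set K := (L + 1).succ * n / m n with hK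
  set x : Fin n → ℝ := fun i => X i ω with hx
  -- With `L'` the cell parameter, `K ≥ 1` turns `L' n < m (K + 1)` into `L' n ≤ 2 m K`.
  have hK1 : 1 ≤ K := by
    rw [hK, Nat.one_le_div_iff hm0]
    nlinarith
  have hmK : m n * K ≤ (L + 1).succ * n := Nat.mul_div_le _ _
  have hlt' : (L + 1).succ * n < m n * (K + 1) :=
     Nat.lt_mul_div_succ _ hm0
  refine (abs_spacing_sub_one_le_of_cellCount (K := K) (L := (L + 1).succ) (by omega) hm0
    (by nlinarith) hmK (w := fun i => cdf μ (orderStat x i))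
    (fun i i' h => monotone_cdf μ (monotone_orderStat x h)) (fun i => cdf_nonneg μ _)
    (fun i => hω1 _) ?_ j).trans hL'
  intro k hk
  have e : (fun i => cdf μ (orderStat x i)) = (fun i => cdf μ (x i)) ∘ Tuple.sort x := rfl
  rw [e, cellCount_comp_perm]
  exact hn k hk

/-! ### Laws with bounded density and conclusion -/

theorem cdf_withDensity_sub_le {f : ℝ → ℝ} {M : ℝ} (hfM : ∀ x, f x ≤ M) (hM : 0 ≤ M)
    [IsProbabilityMeasure (volume.withDensity fun x => ENNReal.ofReal (f x))] {a b : ℝ}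
    (hab : a ≤ b) :
    cdf (volume.withDensity fun x => ENNReal.ofReal (f x)) b -
      cdf (volume.withDensity fun x => ENNReal.ofReal (f x)) a ≤ M * (b - a) := by
  set μ := volume.withDensity fun x => ENNReal.ofReal (f x) with hμ
  have h1 : ENNReal.ofReal (cdf μ b - cdf μ a) ≤ ENNReal.ofReal (M * (b - a)) := by
    rw [← StieltjesFunction.measure_Ioc, measure_cdf, hμ, withDensity_apply _ measurableSet_Ioc,
      ENNReal.ofReal_mul hM, ← Real.volume_Ioc, ← setLIntegral_const]
    exact lintegral_mono fun x => ENNReal.ofReal_le_ofReal (hfM x)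
  exact (ENNReal.ofReal_le_ofReal_iff (mul_nonneg hM (sub_nonneg.2 hab))).1 h1

/-- Lebesgue differentiation: the derivative of a cdf is almost everywhere the Radon–Nikodym
derivative of its measure. -/
theorem ae_hasDerivAt_cdf_withDensity {f : ℝ → ℝ} (hf : Measurable f) (hf0 : ∀ x, 0 ≤ f x)
    [IsProbabilityMeasure (volume.withDensity fun x => ENNReal.ofReal (f x))] :
    ∀ᵐ x, HasDerivAt (cdf (volume.withDensity fun x => ENNReal.ofReal (f x))) (f x) x := by
  set μ := volume.withDensity fun x => ENNReal.ofReal (f x) with hμ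
  filter_upwards [(cdf μ).ae_hasDerivAt,
    Measure.rnDeriv_withDensity volume hf.ennreal_ofReal] with x h1 h2
  rwa [measure_cdf, hμ, h2, ENNReal.toReal_ofReal (hf0 x), ← hμ] at h1

/-- Accounts for the shift by which averages of squares estimate the integral of the cube. -/
theorem integral_pow_withDensity_self {f : ℝ → ℝ} (hf : Measurable f) (hf0 : ∀ x, 0 ≤ f x)
    (p : ℕ) : ∫ x, f x ^ p ∂(volume.withDensity fun x => ENNReal.ofReal (f x)) =
      ∫ x, f x ^ (p + 1) := by
  rw [integral_withDensity_eq_integral_toReal_smul hf.ennreal_ofReal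
    (ae_of_all _ fun _ => ENNReal.ofReal_lt_top)]
  refine integral_congr_ae (ae_of_all _ fun x => ?_)
  simp only [ENNReal.toReal_ofReal (hf0 x), smul_eq_mul]
  ring

theorem varextropy_eq {Ω : Type*} [MeasurableSpace Ω] (P : Measure Ω) [IsProbabilityMeasure P]
    {X : Ω → ℝ} (hX : Measurable X) {f : ℝ → ℝ} (hf : Measurable f) (hf0 : ∀ x, 0 ≤ f x)
    (hlaw : P.map X = volume.withDensity fun x => ENNReal.ofReal (f x))
    {M : ℝ} (hfM : ∀ x, f x ≤ M) :
    varextropy P X f = 1 / 4 * (∫ x, f x ^ 3) - 1 / 4 * (∫ x, f x ^ 2) ^ 2 := by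
  have hmem : MemLp (fun ω => f (X ω)) 2 P :=
    MemLp.of_bound (hf.comp hX).aestronglyMeasurable M (ae_of_all _ fun ω => by
      rw [Real.norm_eq_abs, abs_of_nonneg (hf0 _)]; exact hfM _)
  have hint : ∀ p : ℕ, ∫ ω, f (X ω) ^ p ∂P = ∫ x, f x ^ (p + 1) := by
    intro p
    rw [← integral_pow_withDensity_self hf hf0, ← hlaw,
      integral_map hX.aemeasurable (hf.pow_const p).aestronglyMeasurable]
  rw [varextropy, variance_const_mul, variance_eq_sub hmem]
  have h1 := hint 1
  have h2 := hint 2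
  simp only [pow_one] at h1
  simp only [Pi.pow_apply, h1, h2]
  ring

theorem theorem2p1 {Ω : Type*} [MeasurableSpace Ω] (P : Measure Ω) [IsProbabilityMeasure P]
    (X : ℕ → Ω → ℝ) (hX : ∀ i, Measurable (X i)) (hindep : iIndepFun X P)
    (f : ℝ → ℝ) (hf : Measurable f) (hf_nonneg : ∀ x, 0 ≤ f x)
    (hlaw : ∀ i, P.map (X i) = volume.withDensity (fun x => ENNReal.ofReal (f x)))
    (hf_bdd : ∃ M : ℝ, ∀ x, f x ≤ M)
    (m : ℕ → ℕ) (hm : Tendsto m atTop atTop)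
    (hm_log : Tendsto (fun n : ℕ => (m n : ℝ) / Real.log (n : ℝ)) atTop atTop)
    (hm_div : Tendsto (fun n : ℕ => (m n : ℝ) / (n : ℝ)) atTop (𝓝 0)) :
    varextropy P (X 0) f = 1 / 4 * (∫ x, f x ^ 3) - 1 / 4 * (∫ x, f x ^ 2) ^ 2 ∧
    ∀ᵐ ω ∂P, Tendsto (fun n : ℕ => VJV (m n) (fun i : Fin n => X i ω)) atTop
      (𝓝 (varextropy P (X 0) f)) := by
  obtain ⟨M, hfM⟩ := hf_bdd
  have hM : 0 ≤ M := (hf_nonneg 0).trans (hfM 0)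
  have hvar := varextropy_eq P (hX 0) hf hf_nonneg (hlaw 0) hfM
  refine ⟨hvar, ?_⟩
  have hprob : IsProbabilityMeasure (volume.withDensity fun x => ENNReal.ofReal (f x)) := by
    rw [← hlaw 0]
    exact Measure.isProbabilityMeasure_map (hX 0).aemeasurable
  have hLip : ∀ a b, a ≤ b → _ := fun a b hab => cdf_withDensity_sub_le hfM hM (a := a) (b := b) hab
  have hderiv := (withDensity_absolutelyContinuous volume fun x => ENNReal.ofReal (f x)).ae_le
    (ae_hasDerivAt_cdf_withDensity hf hf_nonneg)
  -- The law does not charge the zero set of its density.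
  have hpos : ∀ᵐ x ∂(volume.withDensity fun x => ENNReal.ofReal (f x)), 0 < f x := by
    rw [ae_withDensity_iff hf.ennreal_ofReal]
    refine ae_of_all _ fun x hx => ?_
    simpa using hx
  have hint := integral_pow_withDensity_self hf hf_nonneg
  set μ := volume.withDensity fun x => ENNReal.ofReal (f x) with hμ
  have hc : Continuous (cdf μ) := by
    refine (LipschitzWith.of_le_add_mul M.toNNReal fun x y => ?_).continuous
    rw [Real.coe_toNNReal _ hM]
    rcases le_total y x with h | h
    · rw [Real.dist_eq, abs_of_nonneg (sub_nonneg.2 h)]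
      linarith [hLip y x h]
    · linarith [monotone_cdf μ h, mul_nonneg hM (dist_nonneg (x := x) (y := y))]
  filter_upwards [ae_eventually_abs_spacing_sub_one_le P X hX hindep μ hlaw hc m hm hm_log hm_div]
    with ω hω
  have hT := tendsto_average_spacingDensity_pow μ f hf M hf_nonneg hfM hderiv hpos hLip m hm hm_div
    (fun n i => X i ω) hω
  have hT2 := hT 2
  have hT1 := hT 1
  rw [hint] at hT1 hT2
  simp only [pow_one] at hT1
  rw [hvar, ← mul_sub]
  exact (hT2.sub (hT1.pow 2)).const_mul (1 / 4)
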